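/- Let $b\ge 0$ be an integer and let $g:\mathbb R\to\mathbb R$ be a real-valued, $1$-periodic bandlimited field $g(t)=\sum_{k=-b}^{b}a_k e^{2\pi i k t}$, with coefficient vector $\vec a=(a_{-b},\dots,a_b)^T\in\mathbb C^{2b+1}$. Put $s_b=1/(2b+1)$, $\vec u=(0,s_b,2s_b,\dots,2bs_b)^T$, $\Phi(t)=(e^{2\pi i k t})_{k=-b}^{b}$, and let $\Phi_b$ be the $(2b+1)\times(2b+1)$ matrix with entries $(\Phi_b)_{l,k}=e^{2\pi i k l s_b}$, $l=0,\dots,2b$, $k=-b,\dots,b$. Let $U_1,U_2,\dots$ be i.i.d. uniform on $[0,1]$, let $U_{1:n}\le\dots\le U_{n:n}$ be the ordered values of $U_1,\dots,U_n$, and define $$\vec G=\bigl(g(U_{\lfloor n l s_b\rfloor+1:n})\bigr)_{l=0}^{2b},\qquad \vec A=\frac1{2b+1}\Phi_b^\dagger\vec G,\qquad \widehat G(t)=\Phi(t)^T\vec A .$$ Let $K_U$ be the symmetric matrix with entries $(K_U)_{l,l'}=l s_b(1-l' s_b)$ for $0\le l\le l'\le 2b$, let $\nabla g(\vec u)=\operatorname{diag}(g'(0),g'(s_b),\dots,g'(2bs_b))$,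 and $K_G=\nabla g(\vec u)^TK_U\nabla g(\vec u)$. Then, as $n\to\infty$: 1. $\sqrt n(\vec A-\vec a)$ converges in distribution to a centred (possibly degenerate) complex Gaussian vector $S$ whose covariance structure $K_A$ does not depend on $n$ and is given by $$\mathbb E[SS^\dagger]=\frac1{(2b+1)^2}\Phi_b^\dagger K_G\Phi_b,\qquad \mathbb E[SS^T]=\frac1{(2b+1)^2}\Phi_b^\dagger K_G\overline{\Phi_b}.$$ 2. For every $t\in\mathbb R$, $\sqrt n(\widehat G(t)-g(t))$ converges in distribution to a centred (possibly degenerate) complex Gaussian variable $Z_t$ whose variance structure does not depend on $n$ and is given by $$\mathbb E|Z_t|^2=\frac1{(2b+1)^2}\Phi(t)^T\Phi_b^\dagger K_G\Phi_b\overline{\Phi(t)},\qquad \mathbb E[Z_t^2]=\frac1{(2b+1)^2}\Phi(t)^T\Phi_b^\dagger K_G\overline{\Phi_b}\,\Phi(t).$$ -/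

import Mathlib

open MeasureTheory ProbabilityTheory Filter Matrix

noncomputable section

namespace RandomSampling

/-- The order statistic `x_{r:n}` (with `r` counted from `1`): the `r`-th smallest of the `n` numbers
`x`, with repetitions. The value `0` outside `1 ≤ r ≤ n` is a convention that is never used
for `n ≥ 1` below, see `rank_mem`. -/
def orderStat {n : ℕ} (x : Fin n → ℝ) (r : ℕ) : ℝ :=
  if h : 1 ≤ r ∧ r ≤ n then x (Tuple.sort x ⟨r - 1, by omega⟩) else 0

/-- The spacing `s_b = 1 / (2b+1)`. -/
def spacing (b : ℕ) : ℝ := 1 / (2 * (b : ℝ) + 1)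

/-- The point `u_l = l s_b`, for `l = 0, …, 2b`. -/
def gridPoint (b : ℕ) (l : Fin (2 * b + 1)) : ℝ := ((l : ℕ) : ℝ) * spacing b

/-- The rank `[n l s_b] + 1`. -/
def rank (b n : ℕ) (l : Fin (2 * b + 1)) : ℕ := ⌊(n : ℝ) * gridPoint b l⌋₊ + 1

theorem rank_mem (b n : ℕ) (hn : 0 < n) (l : Fin (2 * b + 1)) :
    1 ≤ rank b n l ∧ rank b n l ≤ n := by
  refine ⟨Nat.le_add_left 1 _, ?_⟩
  have hb : (0 : ℝ) < 2 * (b : ℝ) + 1 := by positivity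
  have hn' : (0 : ℝ) < n := by exact_mod_cast hn
  have hl : ((l : ℕ) : ℝ) < 2 * (b : ℝ) + 1 := by exact_mod_cast l.2
  have h1 : gridPoint b l < 1 := by
    unfold gridPoint spacing
    rw [mul_one_div, div_lt_one hb]
    exact hl
  have h0 : 0 ≤ gridPoint b l := by
    unfold gridPoint spacing
    positivity
  have h2 : ⌊(n : ℝ) * gridPoint b l⌋₊ < n := by
    rw [Nat.floor_lt (by positivity)]
    nlinarith
  exact h2

/-- The frequencies `-b, …, b`, indexed by `Fin (2b+1)`. -/
def freq (b : ℕ) (k : Fin (2 * b + 1)) : ℤ := ((k : ℕ) : ℤ) - (b : ℤ)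

/-- The vector `Φ(t) = (exp(2πi k t))_{k = -b, …, b}`. -/
def expVec (b : ℕ) (t : ℝ) (k : Fin (2 * b + 1)) : ℂ :=
  Complex.exp (2 * (Real.pi : ℂ) * Complex.I * (freq b k : ℂ) * (t : ℂ))

/-- The matrix `Φ_b`, whose entry in row `l` and column `k` is `φ_k ^ l`, where
`φ_k = exp(2πi k s_b)`. -/
def Phi (b : ℕ) : Matrix (Fin (2 * b + 1)) (Fin (2 * b + 1)) ℂ :=
  Matrix.of fun l k => expVec b (spacing b) k ^ (l : ℕ)

/-- The vector of field samples at the empirical quantiles, `g(U_{[n l s_b]+1:n})`,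
`l = 0, …, 2b`, for the sample locations `x`. -/
def sampleVec (b : ℕ) (g : ℝ → ℝ) {n : ℕ} (x : Fin n → ℝ) (l : Fin (2 * b + 1)) : ℂ :=
  ((g (orderStat x (rank b n l)) : ℝ) : ℂ)

/-- The estimate `A = (2b+1)⁻¹ Φ_b† G` of the vector of Fourier coefficients. -/
def coeffEst (b : ℕ) (g : ℝ → ℝ) {n : ℕ} (x : Fin n → ℝ) : Fin (2 * b + 1) → ℂ :=
  (1 / (2 * (b : ℂ) + 1)) • ((Phi b)ᴴ *ᵥ sampleVec b g x)

/-- The estimate `Ĝ(t) = Φ(t)ᵀ A` of the field. -/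
def fieldEst (b : ℕ) (g : ℝ → ℝ) {n : ℕ} (x : Fin n → ℝ) (t : ℝ) : ℂ :=
  expVec b t ⬝ᵥ coeffEst b g x

/-- The matrix `K_U`: the symmetric matrix with entries `u_l (1 - u_{l'})` for `l ≤ l'`. -/
def covU (b : ℕ) : Matrix (Fin (2 * b + 1)) (Fin (2 * b + 1)) ℝ :=
  Matrix.of fun l l' => gridPoint b (min l l') * (1 - gridPoint b (max l l'))

/-- The Jacobian matrix `∇g(u)` of `(x_0, …, x_{2b}) ↦ (g(x_0), …, g(x_{2b}))` at `u`. -/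
def gradG (b : ℕ) (g : ℝ → ℝ) : Matrix (Fin (2 * b + 1)) (Fin (2 * b + 1)) ℝ :=
  Matrix.diagonal fun l => deriv g (gridPoint b l)

/-- The matrix `K_G = ∇g(u)ᵀ K_U ∇g(u)`. -/
def covG (b : ℕ) (g : ℝ → ℝ) : Matrix (Fin (2 * b + 1)) (Fin (2 * b + 1)) ℝ :=
  (gradG b g)ᵀ * covU b * gradG b g

/-- `K_G` with its entries regarded as complex numbers. -/
def covGC (b : ℕ) (g : ℝ → ℝ) : Matrix (Fin (2 * b + 1)) (Fin (2 * b + 1)) ℂ :=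
  (covG b g).map fun r : ℝ => (r : ℂ)

/-- The Hermitian part `E[S S†] = (2b+1)⁻² Φ_b† K_G Φ_b` of the covariance structure `K_A`. -/
def covA (b : ℕ) (g : ℝ → ℝ) : Matrix (Fin (2 * b + 1)) (Fin (2 * b + 1)) ℂ :=
  (1 / (2 * (b : ℂ) + 1) ^ 2) • ((Phi b)ᴴ * covGC b g * Phi b)

/-- The pseudo-covariance part `E[S Sᵀ] = (2b+1)⁻² Φ_b† K_G (Φ_b†)ᵀ` of the covariance
structure `K_A`. -/
def pcovA (b : ℕ) (g : ℝ → ℝ) : Matrix (Fin (2 * b + 1)) (Fin (2 * b + 1)) ℂ :=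
  (1 / (2 * (b : ℂ) + 1) ^ 2) • ((Phi b)ᴴ * covGC b g * ((Phi b)ᴴ)ᵀ)

/-- The limiting `E|Z|²` for `Ĝ(t)`:
`(2b+1)⁻² Φ(t)ᵀ Φ_b† K_G Φ_b conj(Φ(t))`. -/
def varGt (b : ℕ) (g : ℝ → ℝ) (t : ℝ) : ℂ :=
  expVec b t ⬝ᵥ (covA b g *ᵥ star (expVec b t))

/-- The limiting `E[Z²]` for `Ĝ(t)`:
`(2b+1)⁻² Φ(t)ᵀ Φ_b† K_G (Φ_b†)ᵀ Φ(t)`. -/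
def pvarGt (b : ℕ) (g : ℝ → ℝ) (t : ℝ) : ℂ :=
  expVec b t ⬝ᵥ (pcovA b g *ᵥ expVec b t)

/-- `ν` is the law of a centred complex Gaussian vector `S` (that is, its real and imaginary parts
are jointly Gaussian, possibly degenerate) with covariance `E[S S†] = K` and pseudo-covariance
`E[S Sᵀ] = C`. Polynomials are integrable for Gaussian laws, so the integrals are genuine. -/
structure IsComplexGaussianVec {ι : Type*} [Fintype ι] (ν : Measure (ι → ℂ))
    (K C : Matrix ι ι ℂ) : Prop where
  gaussian : IsGaussian ν
  mean : ∀ k, ∫ z, z k ∂ν = 0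
  cov : ∀ k l, ∫ z, z k * star (z l) ∂ν = K k l
  pcov : ∀ k l, ∫ z, z k * z l ∂ν = C k l

/-- `ν` is the law of a centred complex Gaussian variable `Z` with `E|Z|² = v`, `E[Z²] = c`. -/
structure IsComplexGaussian (ν : Measure ℂ) (v c : ℂ) : Prop where
  gaussian : IsGaussian ν
  mean : ∫ z, z ∂ν = 0
  var : ∫ z, z * star z ∂ν = v
  pvar : ∫ z, z * z ∂ν = c

end RandomSampling

end

noncomputable section

namespace RandomSampling

open scoped Topology

/-! ### The multivariate central limit theorem. -/

section CentralLimit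

variable {Ω : Type*} [MeasurableSpace Ω] {P : Measure Ω} [IsProbabilityMeasure P]

/-! The randomness enters only through the sample quantiles, which are linearised twice. Let
`N_n(y)` count the first `n` sample points that are at most `y`. The quantile of rank `⌊nu⌋ + 1` is
at most `y` exactly when `nu < N_n(y)`. At `y = u + x/√n`, the increment `(N_n(y) - N_n(u))/√n` has
mean `x` and variance at most `|x|/√n`. Hence the scaled quantile error equals `(nu - N_n(u))/√n` up
to a term vanishing in probability (`tendstoInMeasure_orderStat_sub_countLE`). These counts are sums
of i.i.d. bounded vectors with covariance `min(u,v) - uv`, so the multivariate central limit theorem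
yields the limit `N(0, K_U)` jointly over the grid (`tendstoInDistribution_countLE_grid`).

The delta method and Slutsky's lemma carry the limit through `g`
(`tendstoInDistribution_sample_grid`). The columns of `Φ_b` are orthogonal, so the estimator
recovers `a` exactly from noiseless grid samples (`smul_conjTranspose_Phi_mulVec_grid`). The
coefficient error is therefore a linear image of the sample error, and its limit is the image of
`N(0, K_U)` under `coeffMatrix`. The field error is the further linear image under `Φ(t)ᵀ`. -/

lemma tendstoInDistribution_id_map {E Ω' : Type*} [MeasurableSpace Ω'] {μ : Measure Ω'}
    [IsProbabilityMeasure μ] [TopologicalSpace E] [MeasurableSpace E] [BorelSpace E]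
    {X : ℕ → Ω → E} {Z : Ω' → E} (h : TendstoInDistribution X atTop Z (fun _ => P) μ)
    [IsProbabilityMeasure (μ.map Z)] :
    TendstoInDistribution X atTop id (fun _ => P) (μ.map Z) where
  forall_aemeasurable := h.forall_aemeasurable
  aemeasurable_limit := aemeasurable_id
  tendsto := by
    have h' := h.tendsto
    simpa only [Measure.map_id] using h'

variable {ι : Type*} [Fintype ι]

lemma variance_inner_eq_dotProduct {X : Ω → EuclideanSpace ℝ ι} {S : Matrix ι ι ℝ}
    (hX : ∀ i, MemLp (fun ω => X ω i) 2 P)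
    (hS : ∀ i j, cov[fun ω => X ω i, fun ω => X ω j; P] = S i j) (t : EuclideanSpace ℝ ι) :
    Var[fun ω => inner ℝ (X ω) t; P] = t ⬝ᵥ S *ᵥ t := by
  have h1 : (fun ω => inner ℝ (X ω) t) = fun ω => ∑ i, t i * X ω i := by
    ext ω; simp [PiLp.inner_apply]
  rw [h1, variance_fun_sum (fun i => (hX i).const_mul _)]
  simp only [covariance_const_mul_left, covariance_const_mul_right, hS, dotProduct, mulVec,
    Finset.mul_sum]
  refine Finset.sum_congr rfl fun i _ => Finset.sum_congr rfl fun j _ => ?_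
  ring

/-- The quadratic form is a variance. Semidefiniteness is what makes the characteristic function and
moments of `multivariateGaussian 0 S` computable. -/
lemma posSemidef_of_covariance {X : Ω → EuclideanSpace ℝ ι} {S : Matrix ι ι ℝ}
    (hX : ∀ i, MemLp (fun ω => X ω i) 2 P)
    (hS : ∀ i j, cov[fun ω => X ω i, fun ω => X ω j; P] = S i j) : S.PosSemidef := by
  refine Matrix.PosSemidef.of_dotProduct_mulVec_nonneg ?_ fun x => ?_
  · ext i j
    simp [← hS, covariance_comm]
  · have h := variance_inner_eq_dotProduct hX hS (WithLp.toLp 2 x)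
    rw [WithLp.ofLp_toLp] at h
    simpa only [star_trivial, ← h] using variance_nonneg _ _

variable [DecidableEq ι]

/-- The multivariate central limit theorem for centred random vectors. -/
theorem tendstoInDistribution_inv_sqrt_smul_sum {X : ℕ → Ω → EuclideanSpace ℝ ι}
    {S : Matrix ι ι ℝ} (hX : ∀ i, MemLp (fun ω => X 0 ω i) 2 P) (h0 : ∀ i, ∫ ω, X 0 ω i ∂P = 0)
    (hS : ∀ i j, cov[fun ω => X 0 ω i, fun ω => X 0 ω j; P] = S i j) (hindep : iIndepFun X P)
    (hident : ∀ i, IdentDistrib (X i) (X 0) P P) :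
    TendstoInDistribution (fun (n : ℕ) ω => (√n)⁻¹ • ∑ k ∈ Finset.range n, X k ω) atTop id
      (fun _ => P) (multivariateGaussian 0 S) where
  forall_aemeasurable n :=
    (Finset.aemeasurable_fun_sum (Finset.range n) fun k _ =>
      (hident k).aemeasurable_fst).fun_const_smul _
  aemeasurable_limit := aemeasurable_id
  tendsto := by
    -- Cramér–Wold: the characteristic function of the vector at `t` is that of its projection on
    -- `t` at `1`, so the scalar theorem suffices.
    refine ProbabilityMeasure.tendsto_iff_tendsto_charFun.2 fun t => ?_
    have hmeas : Measurable fun x : EuclideanSpace ℝ ι => inner ℝ x t := by fun_prop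
    have hsum : MemLp (fun ω => inner ℝ (X 0 ω) t) 2 P := by
      have : (fun ω => inner ℝ (X 0 ω) t) = fun ω => ∑ i, t i * X 0 ω i := by
        ext ω; simp [PiLp.inner_apply]
      rw [this]
      exact memLp_finsetSum _ fun i _ => (hX i).const_mul _
    have hmean : ∫ ω, inner ℝ (X 0 ω) t ∂P = 0 := by
      have : (fun ω => inner ℝ (X 0 ω) t) = fun ω => ∑ i, t i * X 0 ω i := by
        ext ω; simp [PiLp.inner_apply]
      rw [this, integral_finsetSum _ fun i _ => ((hX i).integrable (by simp)).const_mul _]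
      simp [integral_const_mul, h0]
    have hvar := variance_inner_eq_dotProduct hX hS t
    have hclt := tendstoInDistribution_inv_sqrt_mul_sum_sub (P := P)
      (X := fun k ω => inner ℝ (X k ω) t) (Y := id) (P' := gaussianReal 0 _)
      ⟨aemeasurable_id, Measure.map_id⟩ hsum
      (hindep.comp (fun _ x => inner ℝ x t) (fun _ => hmeas)) (fun i => (hident i).comp hmeas)
    have hlim := ProbabilityMeasure.tendsto_iff_tendsto_charFun.1 hclt.tendsto 1
    have hae : ∀ n : ℕ, AEMeasurable (fun ω => (√n)⁻¹ • ∑ k ∈ Finset.range n, X k ω) P := fun n =>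
      (Finset.aemeasurable_fun_sum (Finset.range n) fun k _ =>
      (hident k).aemeasurable_fst).fun_const_smul _
    have hnn : 0 ≤ t ⬝ᵥ S *ᵥ t := hvar ▸ variance_nonneg _ _
    have hgoal : ∀ n : ℕ,
        charFun (P.map fun ω => (√n)⁻¹ * (∑ k ∈ Finset.range n, inner ℝ (X k ω) t -
          n * ∫ ω, inner ℝ (X 0 ω) t ∂P)) 1 =
        charFun (P.map fun ω => (√n)⁻¹ • ∑ k ∈ Finset.range n, X k ω) t := by
      intro n
      have hcomp : (fun ω => (√n)⁻¹ * (∑ k ∈ Finset.range n, inner ℝ (X k ω) t -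
          n * ∫ ω, inner ℝ (X 0 ω) t ∂P)) =
          (fun x => inner ℝ x t) ∘ fun ω => (√n)⁻¹ • ∑ k ∈ Finset.range n, X k ω := by
        ext ω
        simp [hmean, real_inner_smul_left, sum_inner]
      rw [hcomp, ← AEMeasurable.map_map_of_aemeasurable hmeas.aemeasurable (hae n),
        charFun_apply_real, charFun_apply, integral_map hmeas.aemeasurable (by fun_prop)]
      simp
    simp only [ProbabilityMeasure.coe_mk, hgoal, Measure.map_id] at hlim ⊢
    convert hlim using 2
    rw [charFun_multivariateGaussian (posSemidef_of_covariance hX hS), charFun_gaussianReal, hvar]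
    simp [Real.coe_toNNReal _ hnn]

end CentralLimit

/-! ### Complex Gaussian laws and their linear images. -/

section ComplexGaussian

variable {ι κ : Type*} [Fintype ι]

lemma IsComplexGaussianVec.map_dotProduct {ν : Measure (ι → ℂ)} {K C : Matrix ι ι ℂ}
    (h : IsComplexGaussianVec ν K C) (e : ι → ℂ) :
    IsComplexGaussian (ν.map fun z => e ⬝ᵥ z) (e ⬝ᵥ K *ᵥ star e) (e ⬝ᵥ C *ᵥ e) := by
  have := h.gaussian
  have hmeas : Measurable fun z : ι → ℂ => e ⬝ᵥ z := by
    unfold dotProduct; fun_prop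
  have hmem : ∀ k, MemLp (fun z : ι → ℂ => z k) 2 ν := fun k =>
    ((ContinuousLinearMap.proj (R := ℝ) (φ := fun _ : ι => ℂ) k).comp_memLp'
      (IsGaussian.memLp_two_id (μ := ν)))
  have hmem' : ∀ k, MemLp (fun z : ι → ℂ => star (z k)) 2 ν := fun k => (hmem k).star
  refine ⟨?_, ?_, ?_, ?_⟩
  -- Gaussianity is a notion over `ℝ`, so the complex-linear form is viewed as a real-linear map.
  · let L : (ι → ℂ) →L[ℝ] ℂ := ∑ k, e k • ContinuousLinearMap.proj (R := ℝ) (φ := fun _ : ι => ℂ) k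
    have hL : (fun z : ι → ℂ => e ⬝ᵥ z) = L := by
      ext z; simp [L, dotProduct]
    rw [hL]; infer_instance
  · rw [integral_map hmeas.aemeasurable (by fun_prop)]
    simp_rw [dotProduct]
    rw [integral_finsetSum _ fun k _ => ((hmem k).integrable (by simp)).const_mul _]
    simp [integral_const_mul, h.mean]
  · rw [integral_map hmeas.aemeasurable (by fun_prop)]
    have hprod : ∀ k l, Integrable (fun z : ι → ℂ => e k * star (e l) * (z k * star (z l))) ν :=
      fun k l => ((hmem k).integrable_mul (hmem' l)).const_mul _
    have hexp : ∀ z : ι → ℂ, (e ⬝ᵥ z) * star (e ⬝ᵥ z) =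
        ∑ k, ∑ l, e k * star (e l) * (z k * star (z l)) := by
      intro z
      simp_rw [dotProduct, star_sum, Finset.sum_mul_sum, star_mul']
      refine Finset.sum_congr rfl fun i _ => Finset.sum_congr rfl fun j _ => ?_
      ring
    simp_rw [hexp]
    rw [integral_finsetSum _ fun i _ => integrable_finsetSum _ fun j _ => hprod i j]
    simp_rw [integral_finsetSum _ fun j _ => hprod _ j, integral_const_mul, h.cov, dotProduct,
      mulVec, dotProduct, Finset.mul_sum]
    refine Finset.sum_congr rfl fun i _ => Finset.sum_congr rfl fun j _ => ?_
    simp; ring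
  · rw [integral_map hmeas.aemeasurable (by fun_prop)]
    have hprod : ∀ k l, Integrable (fun z : ι → ℂ => e k * e l * (z k * z l)) ν :=
      fun k l => ((hmem k).integrable_mul (hmem l)).const_mul _
    have hexp : ∀ z : ι → ℂ, (e ⬝ᵥ z) * (e ⬝ᵥ z) =
        ∑ k, ∑ l, e k * e l * (z k * z l) := by
      intro z
      simp_rw [dotProduct, Finset.sum_mul_sum]
      refine Finset.sum_congr rfl fun i _ => Finset.sum_congr rfl fun j _ => ?_
      ring
    simp_rw [hexp]
    rw [integral_finsetSum _ fun i _ => integrable_finsetSum _ fun j _ => hprod i j]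
    simp_rw [integral_finsetSum _ fun j _ => hprod _ j, integral_const_mul, h.pcov, dotProduct,
      mulVec, dotProduct, Finset.mul_sum]
    refine Finset.sum_congr rfl fun i _ => Finset.sum_congr rfl fun j _ => ?_
    ring

/-- The real-linear map `x ↦ M x` from real vectors to complex vectors. -/
def mulVecReal (M : Matrix κ ι ℂ) : EuclideanSpace ℝ ι →L[ℝ] (κ → ℂ) :=
  LinearMap.toContinuousLinearMap
    { toFun := fun x => M *ᵥ fun i => ((x i : ℝ) : ℂ)
      map_add' := fun x y => by
        rw [← Matrix.mulVec_add]; congr 1; ext i; simp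
      map_smul' := fun c x => by
        ext k; simp [mulVec, dotProduct, Finset.mul_sum]
        refine Finset.sum_congr rfl fun i _ => ?_
        ring }

lemma mulVecReal_apply (M : Matrix κ ι ℂ) (x : EuclideanSpace ℝ ι) (k : κ) :
    mulVecReal M x k = ∑ i, M k i * (x i : ℂ) := rfl

variable [DecidableEq ι]

lemma integrable_coord_mul_coord (S : Matrix ι ι ℝ) (i j : ι) :
    Integrable (fun x : EuclideanSpace ℝ ι => x i * x j) (multivariateGaussian 0 S) :=
  MemLp.integrable_mul
    (IsGaussian.memLp_dual _ (EuclideanSpace.proj (𝕜 := ℝ) i) 2 (by simp))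
    (IsGaussian.memLp_dual _ (EuclideanSpace.proj (𝕜 := ℝ) j) 2 (by simp))

lemma integral_coord (S : Matrix ι ι ℝ) (i : ι) :
    ∫ x, x i ∂(multivariateGaussian 0 S) = 0 := by
  have h := IsGaussian.integral_dual (μ := multivariateGaussian 0 S)
    (EuclideanSpace.proj (𝕜 := ℝ) i)
  simpa using h

lemma integral_coord_mul_coord {S : Matrix ι ι ℝ} (hS : S.PosSemidef) (i j : ι) :
    ∫ x, x i * x j ∂(multivariateGaussian 0 S) = S i j := by
  rw [← covariance_eval_multivariateGaussian (μ := 0) hS i j, covariance]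
  simp [integral_coord]

/-- Since `x` is real, conjugation touches only the coefficients. This one bilinear formula thus
serves both the covariance and the pseudo-covariance. -/
lemma integral_sum_mul_sum {S : Matrix ι ι ℝ} (hS : S.PosSemidef) (v w : ι → ℂ) :
    ∫ x, (∑ i, v i * (x i : ℂ)) * (∑ j, w j * (x j : ℂ)) ∂(multivariateGaussian 0 S) =
      v ⬝ᵥ S.map (fun r : ℝ => (r : ℂ)) *ᵥ w := by
  have h : ∀ x : EuclideanSpace ℝ ι, (∑ i, v i * (x i : ℂ)) * (∑ j, w j * (x j : ℂ)) =
      ∑ i, ∑ j, (v i * w j) * ((x i * x j : ℝ) : ℂ) := by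
    intro x
    rw [Finset.sum_mul_sum]
    refine Finset.sum_congr rfl fun i _ => Finset.sum_congr rfl fun j _ => ?_
    push_cast; ring
  have hprod : ∀ i j, Integrable (fun x : EuclideanSpace ℝ ι => (v i * w j) * ((x i * x j : ℝ) : ℂ))
      (multivariateGaussian 0 S) := fun i j => (integrable_coord_mul_coord S i j).ofReal.const_mul _
  simp_rw [h]
  rw [integral_finsetSum _ fun i _ => integrable_finsetSum _ fun j _ => hprod i j]
  simp_rw [integral_finsetSum _ fun j _ => hprod _ j, integral_const_mul, integral_complex_ofReal,
    integral_coord_mul_coord hS, dotProduct, mulVec, dotProduct, Finset.mul_sum]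
  refine Finset.sum_congr rfl fun i _ => Finset.sum_congr rfl fun j _ => ?_
  simp; ring

lemma isComplexGaussianVec_map_mulVecReal [Fintype κ] {S : Matrix ι ι ℝ} (hS : S.PosSemidef)
    (M : Matrix κ ι ℂ) :
    IsComplexGaussianVec ((multivariateGaussian 0 S).map (mulVecReal M))
      (M * S.map (fun r : ℝ => (r : ℂ)) * Mᴴ) (M * S.map (fun r : ℝ => (r : ℂ)) * Mᵀ) where
  gaussian := inferInstance
  mean k := by
    rw [integral_map (by fun_prop) (Measurable.aestronglyMeasurable (by fun_prop))]
    simp_rw [mulVecReal_apply]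
    rw [integral_finsetSum]
    · simp [integral_const_mul, integral_complex_ofReal, integral_coord]
    · intro i _
      exact ((IsGaussian.integrable_dual _ (EuclideanSpace.proj (𝕜 := ℝ) i)).ofReal).const_mul _
  cov k l := by
    rw [integral_map (by fun_prop) (Measurable.aestronglyMeasurable (by fun_prop))]
    simp_rw [mulVecReal_apply, star_sum, star_mul']
    have := integral_sum_mul_sum hS (M k) (fun j => star (M l j))
    simp only [RCLike.star_def, Complex.conj_ofReal] at this ⊢
    rw [this, Matrix.mul_assoc]
    simp [Matrix.mul_apply, dotProduct, mulVec]
  pcov k l := by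
    rw [integral_map (by fun_prop) (Measurable.aestronglyMeasurable (by fun_prop))]
    simp_rw [mulVecReal_apply]
    rw [integral_sum_mul_sum hS (M k) (M l), Matrix.mul_assoc]
    simp [Matrix.mul_apply, dotProduct, mulVec]

end ComplexGaussian

/-! ### Order statistics through counting. -/

section OrderStatistics

/-- Sorting preserves the count, and in a sorted list the entries at most `a` form an initial
segment. -/
lemma orderStat_le_iff {n r : ℕ} (hr : 1 ≤ r ∧ r ≤ n) (x : Fin n → ℝ) (a : ℝ) :
    orderStat x r ≤ a ↔ r ≤ (Finset.univ.filter fun i => x i ≤ a).card := by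
  rw [orderStat, dif_pos hr]
  have h := Tuple.lt_card_le_iff_apply_le_of_monotone (f := x ∘ Tuple.sort x)
    (j := ⟨r - 1, by omega⟩) (a := a) (Tuple.monotone_sort x)
  have hcard : (Finset.univ.filter fun i => (x ∘ Tuple.sort x) i ≤ a).card =
      (Finset.univ.filter fun i => x i ≤ a).card :=
    Finset.card_equiv (Tuple.sort x) (by simp)
  rw [hcard] at h
  rw [← Function.comp_apply (f := x), ← h]
  show r - 1 < _ ↔ _
  omega

lemma measurable_orderStat (n r : ℕ) : Measurable fun x : Fin n → ℝ => orderStat x r := by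
  by_cases hr : 1 ≤ r ∧ r ≤ n
  · refine measurable_of_Iic fun a => ?_
    have hset : (fun x : Fin n → ℝ => orderStat x r) ⁻¹' Set.Iic a =
        {x | (r : ℝ) ≤ ∑ i, (Set.Iic a).indicator 1 (x i)} := by
      ext x
      rw [Set.mem_preimage, Set.mem_Iic, orderStat_le_iff hr, Set.mem_ofPred_eq]
      simp [Set.indicator_apply]
    rw [hset]
    have hind : Measurable ((Set.Iic a).indicator (1 : ℝ → ℝ)) :=
      measurable_one.indicator measurableSet_Iic
    exact measurableSet_le measurable_const
      (Finset.measurable_fun_sum _ fun i _ => hind.comp (measurable_pi_apply i))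
  · simp [orderStat, hr]

/-- The number of the first `n` terms of `x` that do not exceed `y`. -/
def countLE (x : ℕ → ℝ) (n : ℕ) (y : ℝ) : ℝ :=
  ∑ i ∈ Finset.range n, (Set.Iic y).indicator 1 (x i)

/-- For an integer `N`, `⌊nu⌋ + 1 ≤ N` means `nu < N`: the rank absorbs the floor, leaving no
rounding error. -/
lemma orderStat_floor_le_iff {n : ℕ} (hn : 0 < n) {u : ℝ} (hu : 0 ≤ u) (hu1 : u < 1)
    (x : ℕ → ℝ) (a : ℝ) :
    orderStat (fun i : Fin n => x i) (⌊(n : ℝ) * u⌋₊ + 1) ≤ a ↔ n * u < countLE x n a := by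
  have hn' : (0 : ℝ) < n := by exact_mod_cast hn
  have hlt : ⌊(n : ℝ) * u⌋₊ < n := by
    rw [Nat.floor_lt (by positivity)]
    nlinarith
  have hcount : countLE x n a =
      ((Finset.univ.filter fun i : Fin n => x i ≤ a).card : ℝ) := by
    rw [countLE, Finset.sum_range]
    simp [Set.indicator_apply]
  rw [orderStat_le_iff ⟨Nat.le_add_left 1 _, hlt⟩, hcount, Nat.succ_le_iff,
    Nat.floor_lt (by positivity)]

end OrderStatistics

/-! ### Convergence and boundedness in probability. -/

section Probability

variable {Ω : Type*} [MeasurableSpace Ω] {P : Measure Ω} [IsProbabilityMeasure P]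

/-- A sequence of random variables that is bounded in probability. -/
def BoundedInProbability (P : Measure Ω) (X : ℕ → Ω → ℝ) : Prop :=
  ∀ δ > 0, ∃ M > 0, ∀ᶠ n in atTop, P.real {ω | M ≤ |X n ω|} ≤ δ

lemma tendstoInMeasure_zero_iff {X : ℕ → Ω → ℝ} :
    TendstoInMeasure P X atTop 0 ↔
      ∀ ε > 0, Tendsto (fun n => P.real {ω | ε ≤ |X n ω|}) atTop (𝓝 0) := by
  simp [tendstoInMeasure_iff_measureReal_norm]

lemma tendstoInMeasure_zero_of_eventually_le {X : ℕ → Ω → ℝ}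
    (h : ∀ ε > 0, ∀ δ > 0, ∀ᶠ n in atTop, P.real {ω | ε ≤ |X n ω|} ≤ δ) :
    TendstoInMeasure P X atTop 0 := by
  refine tendstoInMeasure_zero_iff.2 fun ε hε => ?_
  refine Metric.tendsto_nhds.2 fun δ hδ => ?_
  filter_upwards [h ε hε (δ / 2) (by positivity)] with n hn
  rw [Real.dist_eq, sub_zero, abs_of_nonneg measureReal_nonneg]
  linarith

lemma BoundedInProbability.of_tendstoInMeasure_sub {X V : ℕ → Ω → ℝ}
    (hV : BoundedInProbability P V) (h : TendstoInMeasure P (X - V) atTop 0) :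
    BoundedInProbability P X := by
  intro δ hδ
  obtain ⟨M, hM, hVM⟩ := hV (δ / 2) (by positivity)
  refine ⟨M + 1, by positivity, ?_⟩
  have h1 := (tendstoInMeasure_zero_iff.1 h 1 one_pos).eventually_le_const
    (show (0 : ℝ) < δ / 2 by positivity)
  filter_upwards [hVM, h1] with n hn hn1
  have hsub : {ω | M + 1 ≤ |X n ω|} ⊆ {ω | M ≤ |V n ω|} ∪ {ω | 1 ≤ |(X - V) n ω|} := by
    intro ω hω
    simp only [Set.mem_ofPred_eq, Set.mem_union, Pi.sub_apply] at hω ⊢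
    by_contra! hcon
    have := abs_add_le (V n ω) (X n ω - V n ω)
    rw [add_sub_cancel] at this
    linarith
  calc P.real _ ≤ P.real _ := measureReal_mono hsub
    _ ≤ _ := measureReal_union_le _ _
    _ ≤ δ := by linarith

/-- The delta method, as a statement about convergence in probability of the remainder. -/
lemma tendstoInMeasure_deltaMethod {Y : ℕ → Ω → ℝ} {u g' : ℝ} {g : ℝ → ℝ}
    (hY : BoundedInProbability P fun n ω => √n * (Y n ω - u)) (hg : HasDerivAt g g' u) :
    TendstoInMeasure P (fun (n : ℕ) ω => √n * (g (Y n ω) - g u) - g' * (√n * (Y n ω - u)))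
      atTop 0 := by
  refine tendstoInMeasure_zero_of_eventually_le fun ε hε δ hδ => ?_
  obtain ⟨M, hM, hYM⟩ := hY δ hδ
  -- With this slope the remainder is at most `ε / 2` wherever `√n |Y - u| < M`; there, `√n > M / ρ`
  -- also forces `|Y - u| < ρ`.
  have hlit := (hasDerivAt_iff_isLittleO.1 hg).def (show 0 < ε / (2 * M) by positivity)
  obtain ⟨ρ, hρ, hball⟩ := Metric.eventually_nhds_iff.1 hlit
  have hsqrt : ∀ᶠ n : ℕ in atTop, M / ρ < √n :=
    (Real.tendsto_sqrt_atTop.comp tendsto_natCast_atTop_atTop).eventually_gt_atTop _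
  filter_upwards [hYM, hsqrt] with n hn hsn
  refine (measureReal_mono fun ω hω => ?_).trans hn
  simp only [Set.mem_ofPred_eq] at hω ⊢
  by_contra! hcon
  have hpos : 0 < √(n : ℝ) := lt_trans (by positivity) hsn
  rw [abs_mul, abs_of_pos hpos] at hcon
  have hdist : dist (Y n ω) u < ρ := by
    rw [Real.dist_eq]
    rw [div_lt_iff₀ hρ] at hsn
    by_contra! h
    have := mul_le_mul_of_nonneg_left h hpos.le
    linarith
  have hb := hball hdist
  simp only [Real.norm_eq_abs, smul_eq_mul] at hb
  have heq : √n * (g (Y n ω) - g u) - g' * (√n * (Y n ω - u)) =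
      √n * (g (Y n ω) - g u - (Y n ω - u) * g') := by ring
  rw [heq, abs_mul, abs_of_pos hpos] at hω
  have h1 : √n * |g (Y n ω) - g u - (Y n ω - u) * g'| ≤ ε / (2 * M) * (√n * |Y n ω - u|) := by
    calc _ ≤ √n * (ε / (2 * M) * |Y n ω - u|) := mul_le_mul_of_nonneg_left hb hpos.le
      _ = _ := by ring
  have h2 : ε / (2 * M) * (√n * |Y n ω - u|) ≤ ε / (2 * M) * M :=
    mul_le_mul_of_nonneg_left hcon.le (by positivity)
  have h3 : ε / (2 * M) * M = ε / 2 := by field_simp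
  linarith

/-- If the sublevel sets of `X` are `{V < x + D x}` and `D` is small on a fine grid, then `X` is
close to `V`. -/
lemma abs_sub_lt_of_le_iff {X V ε : ℝ} {D : ℝ → ℝ} {K : ℕ} (hX : ∀ x, X ≤ x ↔ V < x + D x)
    (hε : 0 < ε) (hV : |V| < K * ε)
    (hD : ∀ k ∈ Finset.Icc (-(K : ℤ) - 2) (K + 2), |D (k * ε)| < ε) : |X - V| < 3 * ε := by
  obtain ⟨hV1, hV2⟩ := abs_lt.1 hV
  -- `V` lies in the cell `[kε, (k+1)ε)`. Testing at `k + 2` and `k - 1` leaves a margin of one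
  -- cell, which `|D| < ε` cannot bridge, so `(k-1)ε < X ≤ (k+2)ε`.
  set k := ⌊V / ε⌋ with hk
  have hk1 : k * ε ≤ V := (le_div_iff₀ hε).1 (Int.floor_le _)
  have hk2 : V < (k + 1) * ε := (div_lt_iff₀ hε).1 (Int.lt_floor_add_one _)
  have hkK : (-(K : ℤ)) ≤ k := by
    have : (-(K : ℝ)) < k + 1 := lt_of_mul_lt_mul_right (by linarith) hε.le
    have : (-(K : ℤ)) < k + 1 := by exact_mod_cast this
    omega
  have hkK' : k < K := by
    have : (k : ℝ) < K := lt_of_mul_lt_mul_right (by linarith) hε.le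
    exact_mod_cast this
  have hup := abs_lt.1 (hD (k + 2) (by simp only [Finset.mem_Icc]; omega))
  have hlo := abs_lt.1 (hD (k - 1) (by simp only [Finset.mem_Icc]; omega))
  have hX1 := (hX ((k + 2 : ℤ) * ε)).2 (by push_cast at hup ⊢; linarith [hup.1])
  have hX2 : ((k - 1 : ℤ) : ℝ) * ε < X := by
    by_contra! h
    have := (hX _).1 h
    push_cast at this hlo
    linarith [hlo.2]
  push_cast at hX1 hX2
  rw [abs_lt]
  constructor <;> linarith

/-- Pointwise control of `D` suffices: boundedness of `V` confines the argument to a finite grid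
independent of `n`, and a union bound applies. -/
lemma tendstoInMeasure_sub_of_le_iff {X V : ℕ → Ω → ℝ} {D : ℕ → ℝ → Ω → ℝ}
    (hX : ∀ᶠ n in atTop, ∀ ω x, X n ω ≤ x ↔ V n ω < x + D n x ω)
    (hD : ∀ x, TendstoInMeasure P (fun n => D n x) atTop 0) (hV : BoundedInProbability P V) :
    TendstoInMeasure P (X - V) atTop 0 := by
  refine tendstoInMeasure_zero_of_eventually_le fun ε hε δ hδ => ?_
  obtain ⟨M, hM, hVM⟩ := hV (δ / 2) (by positivity)
  have hε' : 0 < ε / 3 := by positivity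
  obtain ⟨K, hK⟩ := exists_nat_ge (M / (ε / 3))
  rw [div_le_iff₀ hε'] at hK
  have hsum : Tendsto (fun n => ∑ k ∈ Finset.Icc (-(K : ℤ) - 2) (K + 2),
      P.real {ω | ε / 3 ≤ |D n (k * (ε / 3)) ω|}) atTop (𝓝 0) := by
    rw [← Finset.sum_const_zero (ι := ℤ) (s := Finset.Icc (-(K : ℤ) - 2) (K + 2))]
    exact tendsto_finsetSum _ fun k _ => tendstoInMeasure_zero_iff.1 (hD _) _ hε'
  filter_upwards [hX, hVM, hsum.eventually_le_const (show (0 : ℝ) < δ / 2 by positivity)]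
    with n hXn hVn hDn
  have hsub : {ω | ε ≤ |(X - V) n ω|} ⊆ {ω | M ≤ |V n ω|} ∪
      ⋃ k ∈ Finset.Icc (-(K : ℤ) - 2) (K + 2), {ω | ε / 3 ≤ |D n (k * (ε / 3)) ω|} := by
    intro ω hω
    by_contra! hcon
    simp only [Set.mem_union, Set.mem_iUnion, Set.mem_ofPred_eq, not_or, not_exists, not_le] at hcon
    have := abs_sub_lt_of_le_iff (hXn ω) hε' (hcon.1.trans_le hK) hcon.2
    simp only [Set.mem_ofPred_eq, Pi.sub_apply] at hω
    linarith
  calc P.real _ ≤ P.real _ := measureReal_mono hsub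
    _ ≤ _ := measureReal_union_le _ _
    _ ≤ P.real {ω | M ≤ |V n ω|} + ∑ k ∈ Finset.Icc (-(K : ℤ) - 2) (K + 2),
      P.real {ω | ε / 3 ≤ |D n (k * (ε / 3)) ω|} := by
        gcongr; exact measureReal_biUnion_finset_le _ _
    _ ≤ δ := by linarith

/-- Chebyshev's inequality; the normalisation cancels the factor `n` in the variance of the sum. -/
lemma measureReal_abs_inv_sqrt_mul_sum_le {Y : ℕ → Ω → ℝ} (hY : MemLp (Y 0) 2 P)
    (hindep : iIndepFun Y P) (hident : ∀ i, IdentDistrib (Y i) (Y 0) P P) {n : ℕ} (hn : 0 < n)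
    {η : ℝ} (hη : 0 < η) :
    P.real {ω | η ≤ |(√n)⁻¹ * (∑ k ∈ Finset.range n, Y k ω - n * P[Y 0])|} ≤
      Var[Y 0; P] / η ^ 2 := by
  have hmem : ∀ k, MemLp (Y k) 2 P := fun k => (hident k).memLp_iff.2 hY
  have hsq : 0 < √(n : ℝ) := Real.sqrt_pos.2 (by exact_mod_cast hn)
  have hmemsum : MemLp (∑ k ∈ Finset.range n, Y k) 2 P := memLp_finsetSum' _ fun k _ => hmem k
  have hmean : ∫ ω, (∑ k ∈ Finset.range n, Y k) ω ∂P = (n : ℝ) * P[Y 0] := by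
    simp only [Finset.sum_apply]
    rw [integral_finsetSum _ fun k _ => (hmem k).integrable (by simp)]
    simp [fun k => (hident k).integral_eq]
  have hvar : Var[∑ k ∈ Finset.range n, Y k; P] = n * Var[Y 0; P] := by
    rw [IndepFun.variance_sum (fun k _ => hmem k)
      (fun i _ j _ hij => hindep.indepFun hij)]
    simp [fun k => (hident k).variance_eq]
  have hcheb := meas_ge_le_variance_div_sq hmemsum (c := √n * η) (by positivity)
  rw [hmean, hvar] at hcheb
  have hset : {ω | η ≤ |(√n)⁻¹ * (∑ k ∈ Finset.range n, Y k ω - n * P[Y 0])|} =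
      {ω | √n * η ≤ |(∑ k ∈ Finset.range n, Y k) ω - n * P[Y 0]|} := by
    ext ω
    simp only [Set.mem_ofPred_eq, Finset.sum_apply, abs_mul, abs_inv, abs_of_pos hsq]
    rw [le_inv_mul_iff₀ hsq]
  rw [hset]
  refine (ENNReal.toReal_le_of_le_ofReal ?_ hcheb).trans (le_of_eq ?_)
  · have := variance_nonneg (Y 0) P
    positivity
  · rw [mul_pow, Real.sq_sqrt (by positivity)]
    have : (n : ℝ) ≠ 0 := by positivity
    field_simp

end Probability

/-! ### The uniform empirical process and its quantiles. -/

section Uniform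

variable {Ω : Type*} [MeasurableSpace Ω] {P : Measure Ω}

lemma measureReal_preimage_Iic {X : Ω → ℝ} (hU : pdf.IsUniform X (Set.Icc (0 : ℝ) 1) P volume)
    {y : ℝ} (hy : y ∈ Set.Icc (0 : ℝ) 1) : P.real (X ⁻¹' Set.Iic y) = y := by
  have h := hU.measure_preimage (by simp) (by simp) (measurableSet_Iic (a := y))
  have hI : Set.Icc (0 : ℝ) 1 ∩ Set.Iic y = Set.Icc 0 y := by
    ext x; simp only [Set.mem_inter_iff, Set.mem_Icc, Set.mem_Iic]
    constructor
    · rintro ⟨⟨h0, -⟩, h1⟩; exact ⟨h0, h1⟩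
    · rintro ⟨h0, h1⟩; exact ⟨⟨h0, h1.trans hy.2⟩, h1⟩
  rw [hI] at h
  simp [measureReal_def, h, hy.1]

lemma identDistrib_of_isUniform {U : ℕ → Ω → ℝ} (hmeas : ∀ i, Measurable (U i))
    (hunif : ∀ i, pdf.IsUniform (U i) (Set.Icc (0 : ℝ) 1) P volume) (i : ℕ) :
    IdentDistrib (U i) (U 0) P P :=
  ⟨(hmeas i).aemeasurable, (hmeas 0).aemeasurable, (hunif i).trans (hunif 0).symm⟩

lemma integral_indicator_Iic {X : Ω → ℝ} (hX : Measurable X)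
    (hU : pdf.IsUniform X (Set.Icc (0 : ℝ) 1) P volume) {y : ℝ} (hy : y ∈ Set.Icc (0 : ℝ) 1) :
    ∫ ω, (Set.Iic y).indicator (1 : ℝ → ℝ) (X ω) ∂P = y := by
  have h : (fun ω => (Set.Iic y).indicator (1 : ℝ → ℝ) (X ω)) = (X ⁻¹' Set.Iic y).indicator 1 := rfl
  rw [h, integral_indicator_one (hX measurableSet_Iic), measureReal_preimage_Iic hU hy]

variable [IsProbabilityMeasure P]

lemma measurable_indicator_Iic (y : ℝ) : Measurable ((Set.Iic y).indicator (1 : ℝ → ℝ)) :=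
  measurable_one.indicator measurableSet_Iic

lemma indicator_Iic_mul_indicator_Iic (y z x : ℝ) :
    (Set.Iic y).indicator (1 : ℝ → ℝ) x * (Set.Iic z).indicator 1 x =
      (Set.Iic (min y z)).indicator 1 x := by
  by_cases hy : x ≤ y <;> by_cases hz : x ≤ z <;> simp [hy, hz]

lemma memLp_indicator_Iic {X : Ω → ℝ} (hX : Measurable X) (y : ℝ) :
    MemLp (fun ω => (Set.Iic y).indicator (1 : ℝ → ℝ) (X ω)) 2 P := by
  refine MemLp.of_bound ((measurable_indicator_Iic y).comp hX).aestronglyMeasurable 1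
    (ae_of_all _ fun ω => ?_)
  by_cases h : X ω ≤ y <;> simp [h]

lemma ae_pos_of_isUniform {X : Ω → ℝ} (hU : pdf.IsUniform X (Set.Icc (0 : ℝ) 1) P volume) :
    ∀ᵐ ω ∂P, 0 < X ω := by
  have h := measureReal_preimage_Iic hU (y := 0) (by simp)
  rw [measureReal_eq_zero_iff] at h
  filter_upwards [measure_eq_zero_iff_ae_notMem.1 h] with ω hω
  simpa using hω

lemma covariance_indicator_Iic {X : Ω → ℝ} (hX : Measurable X)
    (hU : pdf.IsUniform X (Set.Icc (0 : ℝ) 1) P volume) {y z : ℝ} (hy : y ∈ Set.Icc (0 : ℝ) 1)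
    (hz : z ∈ Set.Icc (0 : ℝ) 1) :
    cov[fun ω => (Set.Iic y).indicator (1 : ℝ → ℝ) (X ω),
      fun ω => (Set.Iic z).indicator (1 : ℝ → ℝ) (X ω); P] = min y z - y * z := by
  rw [covariance_eq_sub (memLp_indicator_Iic hX y) (memLp_indicator_Iic hX z)]
  simp only [Pi.mul_apply, indicator_Iic_mul_indicator_Iic]
  rw [integral_indicator_Iic hX hU hy, integral_indicator_Iic hX hU hz,
    integral_indicator_Iic hX hU ⟨le_min hy.1 hz.1, (min_le_left _ _).trans hy.2⟩]

lemma variance_indicator_Iic {X : Ω → ℝ} (hX : Measurable X)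
    (hU : pdf.IsUniform X (Set.Icc (0 : ℝ) 1) P volume) {y : ℝ} (hy : y ∈ Set.Icc (0 : ℝ) 1) :
    Var[fun ω => (Set.Iic y).indicator (1 : ℝ → ℝ) (X ω); P] = y - y * y := by
  have h := covariance_indicator_Iic hX hU hy hy
  rwa [covariance_self (memLp_indicator_Iic hX y).aestronglyMeasurable.aemeasurable,
    min_self] at h

/-- The exact value is `|t - s| - (t - s)²`. The linear bound makes empirical increments over
lengths of order `n^{-1/2}` negligible. -/
lemma variance_indicator_Iic_sub_le {X : Ω → ℝ} (hX : Measurable X)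
    (hU : pdf.IsUniform X (Set.Icc (0 : ℝ) 1) P volume) {s t : ℝ} (hs : s ∈ Set.Icc (0 : ℝ) 1)
    (ht : t ∈ Set.Icc (0 : ℝ) 1) :
    Var[fun ω => (Set.Iic t).indicator (1 : ℝ → ℝ) (X ω) - (Set.Iic s).indicator 1 (X ω); P] ≤
      |t - s| := by
  rw [variance_fun_sub (memLp_indicator_Iic hX t) (memLp_indicator_Iic hX s),
    variance_indicator_Iic hX hU ht, variance_indicator_Iic hX hU hs,
    covariance_indicator_Iic hX hU ht hs]
  have h1 : t + s - 2 * min t s = |t - s| := by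
    rcases le_total t s with h | h
    · rw [min_eq_left h, abs_of_nonpos (by linarith)]; ring
    · rw [min_eq_right h, abs_of_nonneg (by linarith)]; ring
  nlinarith [sq_nonneg (t - s)]

variable {U : ℕ → Ω → ℝ}

/-- The increment of the uniform empirical process over an interval of length `O(n^{-1/2})`
vanishes in probability. -/
lemma tendstoInMeasure_countLE_increment (hmeas : ∀ i, Measurable (U i)) (hindep : iIndepFun U P)
    (hunif : ∀ i, pdf.IsUniform (U i) (Set.Icc (0 : ℝ) 1) P volume) {u : ℝ}
    (hu : u ∈ Set.Icc (0 : ℝ) 1) {x : ℝ}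
    (hx : ∀ᶠ n : ℕ in atTop, u + x / √n ∈ Set.Icc (0 : ℝ) 1) :
    TendstoInMeasure P (fun (n : ℕ) ω => (√n)⁻¹ * (countLE (fun i => U i ω) n (u + x / √n) -
      countLE (fun i => U i ω) n u) - x) atTop 0 := by
  refine tendstoInMeasure_zero_iff.2 fun ε hε => ?_
  have hlim : Tendsto (fun n : ℕ => |x| / √n / ε ^ 2) atTop (𝓝 0) := by
    have := (Tendsto.const_div_atTop (Real.tendsto_sqrt_atTop.comp tendsto_natCast_atTop_atTop)
      |x|).div_const (ε ^ 2)
    simpa using this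
  refine squeeze_zero' (.of_forall fun _ => measureReal_nonneg) ?_ hlim
  filter_upwards [hx, eventually_gt_atTop 0] with n hxn hn
  have hsq : 0 < √(n : ℝ) := Real.sqrt_pos.2 (by exact_mod_cast hn)
  let f : ℝ → ℝ := fun y => (Set.Iic (u + x / √n)).indicator 1 y - (Set.Iic u).indicator 1 y
  have hf : Measurable f := (measurable_indicator_Iic _).sub (measurable_indicator_Iic _)
  have hmem : MemLp (fun ω => f (U 0 ω)) 2 P :=
    (memLp_indicator_Iic (hmeas 0) _).sub (memLp_indicator_Iic (hmeas 0) _)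
  have hmean : ∫ ω, f (U 0 ω) ∂P = x / √n := by
    simp only [f]
    rw [integral_sub ((memLp_indicator_Iic (hmeas 0) _).integrable (by simp))
      ((memLp_indicator_Iic (hmeas 0) _).integrable (by simp)),
      integral_indicator_Iic (hmeas 0) (hunif 0) hxn, integral_indicator_Iic (hmeas 0) (hunif 0) hu]
    ring
  have h := measureReal_abs_inv_sqrt_mul_sum_le (Y := fun i ω => f (U i ω)) hmem
    (hindep.comp (fun _ => f) fun _ => hf)
    (fun i => (identDistrib_of_isUniform hmeas hunif i).comp hf) hn hε
  have hset : ∀ ω, (√n)⁻¹ * (∑ k ∈ Finset.range n, f (U k ω) - n * ∫ ω, f (U 0 ω) ∂P) =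
      (√n)⁻¹ * (countLE (fun i => U i ω) n (u + x / √n) - countLE (fun i => U i ω) n u) - x := by
    intro ω
    rw [hmean, countLE, countLE, ← Finset.sum_sub_distrib, mul_sub]
    congr 1
    field_simp
    rw [Real.sq_sqrt (by positivity)]
  simp only [hset] at h
  refine h.trans ?_
  gcongr
  refine (variance_indicator_Iic_sub_le (hmeas 0) (hunif 0) hu hxn).trans (le_of_eq ?_)
  rw [add_sub_cancel_left, abs_div, abs_of_pos hsq]

lemma boundedInProbability_countLE (hmeas : ∀ i, Measurable (U i)) (hindep : iIndepFun U P)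
    (hunif : ∀ i, pdf.IsUniform (U i) (Set.Icc (0 : ℝ) 1) P volume) {u : ℝ}
    (hu : u ∈ Set.Icc (0 : ℝ) 1) :
    BoundedInProbability P fun n ω => (√n)⁻¹ * (n * u - countLE (fun i => U i ω) n u) := by
  intro δ hδ
  have hf := measurable_indicator_Iic u
  -- Chebyshev with variance at most `1` gives the bound `1 / M² = δ`.
  refine ⟨√(1 / δ), Real.sqrt_pos.2 (by positivity), ?_⟩
  filter_upwards [eventually_gt_atTop 0] with n hn
  have h := measureReal_abs_inv_sqrt_mul_sum_le
    (Y := fun i ω => (Set.Iic u).indicator (1 : ℝ → ℝ) (U i ω)) (memLp_indicator_Iic (hmeas 0) u)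
    (hindep.comp (fun _ => (Set.Iic u).indicator (1 : ℝ → ℝ)) fun _ => hf)
    (fun i => (identDistrib_of_isUniform hmeas hunif i).comp hf) hn
    (Real.sqrt_pos.2 (show 0 < 1 / δ by positivity))
  rw [integral_indicator_Iic (hmeas 0) (hunif 0) hu, Real.sq_sqrt (by positivity),
    variance_indicator_Iic (hmeas 0) (hunif 0) hu] at h
  have hset : ∀ ω, |(√n)⁻¹ * (n * u - countLE (fun i => U i ω) n u)| =
      |(√n)⁻¹ * (∑ k ∈ Finset.range n, (Set.Iic u).indicator (1 : ℝ → ℝ) (U k ω) - n * u)| := by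
    intro ω
    rw [abs_mul, abs_mul, abs_sub_comm, countLE]
  simp only [hset]
  refine h.trans ?_
  rw [div_div_eq_mul_div, div_one]
  have : u - u * u ≤ 1 := by nlinarith [hu.1, hu.2]
  nlinarith

/-- The Bahadur representation of the quantile process of a uniform sample, with a remainder that
vanishes in probability. -/
theorem tendstoInMeasure_orderStat_sub_countLE (hmeas : ∀ i, Measurable (U i))
    (hindep : iIndepFun U P)
    (hunif : ∀ i, pdf.IsUniform (U i) (Set.Icc (0 : ℝ) 1) P volume) {u : ℝ} (hu : 0 ≤ u)
    (hu1 : u < 1) :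
    TendstoInMeasure P ((fun (n : ℕ) ω =>
      √n * (orderStat (fun i : Fin n => U i ω) (⌊(n : ℝ) * u⌋₊ + 1) - u)) -
      fun (n : ℕ) ω => (√n)⁻¹ * (n * u - countLE (fun i => U i ω) n u)) atTop 0 := by
  have hle : ∀ n : ℕ, 0 < n → ∀ ω x,
      √n * (orderStat (fun i : Fin n => U i ω) (⌊(n : ℝ) * u⌋₊ + 1) - u) ≤ x ↔
      (√n)⁻¹ * (n * u - countLE (fun i => U i ω) n u) < x + ((√n)⁻¹ *
        (countLE (fun i => U i ω) n (u + x / √n) - countLE (fun i => U i ω) n u) - x) := by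
    intro n hn ω x
    have hsq : 0 < √(n : ℝ) := Real.sqrt_pos.2 (by exact_mod_cast hn)
    rw [add_sub_cancel, mul_lt_mul_iff_right₀ (inv_pos.2 hsq), sub_lt_sub_iff_right,
      ← orderStat_floor_le_iff hn hu hu1, ← le_div_iff₀' hsq, sub_le_iff_le_add']
  have hlim : ∀ x : ℝ, Tendsto (fun n : ℕ => u + x / √n) atTop (𝓝 u) := by
    intro x
    simpa using (Tendsto.const_div_atTop
      (Real.tendsto_sqrt_atTop.comp tendsto_natCast_atTop_atTop) x).const_add u
  -- At `u = 0` the point `u + x/√n` leaves `[0, 1]` for negative `x`, so the increment lemma is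
  -- unavailable there. Instead the count at `0` vanishes almost surely and the minimum is
  -- nonnegative, so only `x = ε / 2` is needed.
  rcases hu.eq_or_lt with rfl | hpos
  · refine tendstoInMeasure_zero_iff.2 fun ε hε => ?_
    have hD := tendstoInMeasure_zero_iff.1
      (tendstoInMeasure_countLE_increment hmeas hindep hunif (u := 0) (x := ε / 2) (by simp) (by
        filter_upwards [(hlim (ε / 2)).eventually_lt_const hu1] with n hn
        exact ⟨by positivity, hn.le⟩)) (ε / 2) (by positivity)
    refine squeeze_zero' (.of_forall fun _ => measureReal_nonneg) ?_ hD
    filter_upwards [eventually_gt_atTop 0] with n hn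
    have hae : ∀ᵐ ω ∂P, ∀ i, 0 < U i ω := ae_all_iff.2 fun i => ae_pos_of_isUniform (hunif i)
    refine ENNReal.toReal_mono (measure_ne_top _ _) (measure_mono_ae ?_)
    filter_upwards [hae] with ω hω hmem
    have hcount : countLE (fun i => U i ω) n 0 = 0 :=
      Finset.sum_eq_zero fun i _ => by simp [hω i]
    have hnonneg : 0 ≤ orderStat (fun i : Fin n => U i ω) (⌊(n : ℝ) * 0⌋₊ + 1) := by
      rw [orderStat]
      split_ifs
      · exact (hω _).le
      · exact le_rfl
    have hX : ε ≤ |√n * (orderStat (fun i : Fin n => U i ω) (⌊(n : ℝ) * 0⌋₊ + 1) - 0) -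
        (√n)⁻¹ * (n * 0 - countLE (fun i => U i ω) n 0)| := hmem
    have hzero : (√n)⁻¹ * ((n : ℝ) * 0 - 0) = 0 := by simp
    rw [hcount, hzero, sub_zero (√n * _), abs_of_nonneg (by
      rw [sub_zero]; positivity)] at hX
    show ε / 2 ≤ |_|
    by_contra! hcon
    have := (hle n hn ω (ε / 2)).2 (by
      rw [hcount] at hcon ⊢
      simp only [mul_zero, sub_zero] at hcon ⊢
      linarith [(abs_lt.1 hcon).1])
    linarith
  · refine tendstoInMeasure_sub_of_le_iff ?_ (fun x =>
      tendstoInMeasure_countLE_increment (x := x) hmeas hindep hunif ⟨hu, hu1.le⟩ ?_)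
      (boundedInProbability_countLE hmeas hindep hunif ⟨hu, hu1.le⟩)
    · filter_upwards [eventually_gt_atTop 0] with n hn
      exact hle n hn
    · filter_upwards [(hlim x).eventually_lt_const hu1, (hlim x).eventually_const_lt hpos]
        with n h1 h2
      exact ⟨h2.le, h1.le⟩

end Uniform

/-! ### Discrete Fourier inversion on the grid. -/

section DiscreteFourier

lemma gridPoint_nonneg (b : ℕ) (l : Fin (2 * b + 1)) : 0 ≤ gridPoint b l := by
  unfold gridPoint spacing
  positivity

lemma gridPoint_lt_one (b : ℕ) (l : Fin (2 * b + 1)) : gridPoint b l < 1 := by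
  have hl : ((l : ℕ) : ℝ) < 2 * (b : ℝ) + 1 := by exact_mod_cast l.2
  unfold gridPoint spacing
  rwa [mul_one_div, div_lt_one (by positivity)]

lemma gridPoint_monotone (b : ℕ) : Monotone (gridPoint b) := by
  intro l l' h
  have : ((l : ℕ) : ℝ) ≤ (l' : ℕ) := by exact_mod_cast h
  unfold gridPoint spacing
  gcongr

lemma expVec_spacing_pow (b l : ℕ) (k : Fin (2 * b + 1)) :
    expVec b (spacing b) k ^ l = expVec b (l * spacing b) k := by
  rw [expVec, expVec, ← Complex.exp_nat_mul]
  congr 1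
  push_cast
  ring

lemma Phi_apply (b : ℕ) (l k : Fin (2 * b + 1)) : Phi b l k = expVec b (gridPoint b l) k :=
  expVec_spacing_pow b l k

lemma star_expVec (b : ℕ) (t : ℝ) (k : Fin (2 * b + 1)) :
    star (expVec b t k) = expVec b (-t) k := by
  rw [expVec, expVec, RCLike.star_def, ← Complex.exp_conj]
  congr 1
  simp [map_ofNat]

lemma star_expVec_mul_expVec_eq_one_iff (b : ℕ) (k k' : Fin (2 * b + 1)) :
    star (expVec b (spacing b) k) * expVec b (spacing b) k' = 1 ↔ k = k' := by
  have hb : (2 * (b : ℂ) + 1) ≠ 0 := by exact_mod_cast (by omega : 2 * b + 1 ≠ 0)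
  have hpi := Complex.two_pi_I_ne_zero
  rw [star_expVec, expVec, expVec, ← Complex.exp_add, Complex.exp_eq_one_iff]
  constructor
  · rintro ⟨m, hm⟩
    have h1 : ((freq b k' - freq b k : ℤ) : ℂ) = ((m * (2 * b + 1) : ℤ) : ℂ) := by
      have h2 : (2 * (Real.pi : ℂ) * Complex.I) * (((freq b k' : ℂ) - freq b k) * spacing b) =
          (2 * (Real.pi : ℂ) * Complex.I) * m := by
        rw [mul_comm _ (m : ℂ), ← hm]
        push_cast
        ring
      have h3 := mul_left_cancel₀ hpi h2
      have hs : ((spacing b : ℝ) : ℂ) = 1 / (2 * (b : ℂ) + 1) := by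
        unfold spacing; push_cast; rfl
      rw [hs, mul_one_div, div_eq_iff hb] at h3
      push_cast
      exact h3
    have h2 : freq b k' - freq b k = m * (2 * b + 1) := by exact_mod_cast h1
    -- Two frequencies differ by at most `2b`, hence by no nonzero multiple of `2b + 1`.
    have hm0 : m = 0 := by
      unfold freq at h2
      have hk := k.2
      have hk' := k'.2
      by_contra hne
      rcases lt_or_gt_of_ne hne with h | h
      · have : m * (2 * (b : ℤ) + 1) ≤ -1 * (2 * b + 1) :=
          mul_le_mul_of_nonneg_right (by omega) (by omega)
        omega
      · have : 1 * (2 * (b : ℤ) + 1) ≤ m * (2 * b + 1) :=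
          mul_le_mul_of_nonneg_right (by omega) (by omega)
        omega
    rw [hm0, zero_mul] at h2
    unfold freq at h2
    exact Fin.ext (by omega)
  · rintro rfl
    exact ⟨0, by push_cast; ring⟩

/-- The columns of `Φ_b` are orthogonal, with square norm `2b+1`. -/
lemma conjTranspose_Phi_mul_Phi (b : ℕ) : (Phi b)ᴴ * Phi b = (2 * (b : ℂ) + 1) • 1 := by
  ext k k'
  -- Each entry is a geometric sum whose ratio `w` is a `(2b+1)`-th root of unity.
  set w := star (expVec b (spacing b) k) * expVec b (spacing b) k' with hw
  have hsum : ((Phi b)ᴴ * Phi b) k k' = ∑ l ∈ Finset.range (2 * b + 1), w ^ l := by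
    rw [Matrix.mul_apply, Finset.sum_range]
    refine Finset.sum_congr rfl fun l _ => ?_
    rw [conjTranspose_apply, Phi, of_apply, of_apply, star_pow, hw, mul_pow]
  rw [hsum]
  by_cases h : k = k'
  · have hw1 : w = 1 := (star_expVec_mul_expVec_eq_one_iff b k k').2 h
    simp [hw1, h]
  · have hw1 : w ≠ 1 := fun h' => h ((star_expVec_mul_expVec_eq_one_iff b k k').1 h')
    have hpow : ∀ j, expVec b (spacing b) j ^ (2 * b + 1) = 1 := by
      intro j
      rw [expVec_spacing_pow, expVec, Complex.exp_eq_one_iff]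
      refine ⟨freq b j, ?_⟩
      have : ((2 * b + 1 : ℕ) : ℝ) * spacing b = 1 := by
        unfold spacing
        push_cast
        exact mul_one_div_cancel (by positivity)
      rw [this]
      push_cast
      ring
    have hwpow : w ^ (2 * b + 1) = 1 := by
      rw [hw, mul_pow, ← star_pow, hpow, hpow, star_one, mul_one]
    rw [geom_sum_eq hw1, hwpow]
    simp [h]

variable {b : ℕ} {g : ℝ → ℝ} {a : Fin (2 * b + 1) → ℂ}

/-- The grid values are `Φ_b a`, and orthogonality inverts `Φ_b`. Thus `a` is the estimator's value
at the noiseless samples, so the error has no bias from aliasing. -/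
lemma smul_conjTranspose_Phi_mulVec_grid (hg : ∀ t : ℝ, (g t : ℂ) = expVec b t ⬝ᵥ a) :
    (1 / (2 * (b : ℂ) + 1)) • ((Phi b)ᴴ *ᵥ fun l => (g (gridPoint b l) : ℂ)) = a := by
  have hb : (2 * (b : ℂ) + 1) ≠ 0 := by exact_mod_cast (by omega : 2 * b + 1 ≠ 0)
  have hgrid : (fun l => (g (gridPoint b l) : ℂ)) = Phi b *ᵥ a := by
    ext l
    rw [hg, mulVec]
    congr 1
    ext k
    rw [Phi_apply]
  rw [hgrid, mulVec_mulVec, conjTranspose_Phi_mul_Phi, smul_mulVec, one_mulVec, smul_smul,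
    one_div_mul_cancel hb, one_smul]

lemma differentiable_of_eq_expVec_dotProduct (hg : ∀ t : ℝ, (g t : ℂ) = expVec b t ⬝ᵥ a) :
    Differentiable ℝ g := by
  have h : g = fun t : ℝ => (expVec b t ⬝ᵥ a).re := by
    ext t
    rw [← hg, Complex.ofReal_re]
  rw [h]
  have hd : Differentiable ℝ fun t : ℝ => expVec b t ⬝ᵥ a := by
    unfold dotProduct expVec
    have : Differentiable ℝ fun t : ℝ => (t : ℂ) := Complex.ofRealCLM.differentiable
    fun_prop
  exact Complex.reCLM.differentiable.comp hd

end DiscreteFourier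

/-! ### Assembling the limit laws. -/

section Limit

variable {Ω : Type*} [MeasurableSpace Ω] {P : Measure Ω} [IsProbabilityMeasure P]

lemma tendstoInMeasure_add_const_mul {R B : ℕ → Ω → ℝ} (hR : TendstoInMeasure P R atTop 0)
    (hB : TendstoInMeasure P B atTop 0) (c : ℝ) :
    TendstoInMeasure P (fun n ω => R n ω + c * B n ω) atTop 0 := by
  refine tendstoInMeasure_zero_iff.2 fun ε hε => ?_
  -- The added `1` covers `c = 0` without a case split.
  have hc : 0 < |c| + 1 := by positivity
  have hlim := (tendstoInMeasure_zero_iff.1 hR (ε / 2) (by positivity)).add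
    (tendstoInMeasure_zero_iff.1 hB (ε / 2 / (|c| + 1)) (by positivity))
  rw [add_zero] at hlim
  refine squeeze_zero (fun _ => measureReal_nonneg) (fun n => ?_) hlim
  refine (measureReal_mono (fun ω hω => ?_)).trans (measureReal_union_le _ _)
  by_contra! hcon
  simp only [Set.mem_union, Set.mem_ofPred_eq, not_or, not_le] at hω hcon
  obtain ⟨h1, h2⟩ := hcon
  rw [lt_div_iff₀ hc] at h2
  have h3 := abs_add_le (R n ω) (c * B n ω)
  rw [abs_mul] at h3
  nlinarith [abs_nonneg (B n ω)]

lemma tendstoInMeasure_pi {ι : Type*} [Fintype ι] {X : ℕ → Ω → ι → ℝ}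
    (hX : ∀ i, TendstoInMeasure P (fun n ω => X n ω i) atTop 0) :
    TendstoInMeasure P X atTop 0 := by
  refine tendstoInMeasure_iff_measureReal_norm.2 fun ε hε => ?_
  have hlim := tendsto_finsetSum Finset.univ fun i _ => tendstoInMeasure_zero_iff.1 (hX i) ε hε
  rw [Finset.sum_const_zero] at hlim
  refine squeeze_zero (fun _ => measureReal_nonneg) (fun n => ?_) hlim
  refine (measureReal_mono (fun ω hω => ?_) (measure_ne_top _ _)).trans
    (measureReal_biUnion_finset_le Finset.univ _)
  by_contra! hcon
  simp only [Set.mem_iUnion, Set.mem_ofPred_eq, Finset.mem_univ, exists_prop, true_and, not_exists,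
    not_le, Pi.zero_apply, sub_zero] at hω hcon
  exact absurd ((pi_norm_lt_iff hε).2 hcon) (not_lt.2 hω)

variable {U : ℕ → Ω → ℝ}

/-- Joint central limit theorem for the uniform empirical distribution function on the grid. -/
lemma tendstoInDistribution_countLE_grid (hmeas : ∀ i, Measurable (U i)) (hindep : iIndepFun U P)
    (hunif : ∀ i, pdf.IsUniform (U i) (Set.Icc (0 : ℝ) 1) P volume) (b : ℕ) :
    (covU b).PosSemidef ∧
    TendstoInDistribution (fun (n : ℕ) ω => WithLp.toLp 2 fun l : Fin (2 * b + 1) =>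
      (√n)⁻¹ * (n * gridPoint b l - countLE (fun i => U i ω) n (gridPoint b l)))
      atTop id (fun _ => P) (multivariateGaussian 0 (covU b)) := by
  have hmem : ∀ l, gridPoint b l ∈ Set.Icc (0 : ℝ) 1 := fun l =>
    ⟨gridPoint_nonneg b l, (gridPoint_lt_one b l).le⟩
  -- The sign matches the linearised quantile: too few points below `u` push the quantile up.
  let f : ℝ → EuclideanSpace ℝ (Fin (2 * b + 1)) := fun x => WithLp.toLp 2 fun l =>
    gridPoint b l - (Set.Iic (gridPoint b l)).indicator 1 x
  have hf : Measurable f := (WithLp.measurable_toLp 2 _).comp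
    (measurable_pi_lambda _ fun l => measurable_const.sub (measurable_indicator_Iic _))
  have hL2 : ∀ l, MemLp (fun ω => f (U 0 ω) l) 2 P := fun l =>
    (memLp_const (gridPoint b l)).sub (memLp_indicator_Iic (hmeas 0) (gridPoint b l))
  have hcov : ∀ l l', cov[fun ω => f (U 0 ω) l, fun ω => f (U 0 ω) l'; P] = covU b l l' := by
    intro l l'
    simp only [f]
    rw [covariance_const_sub_left ((memLp_indicator_Iic (hmeas 0) _).integrable (by simp)),
      covariance_const_sub_right ((memLp_indicator_Iic (hmeas 0) _).integrable (by simp)),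
      neg_neg, covariance_indicator_Iic (hmeas 0) (hunif 0) (hmem l) (hmem l'), covU, of_apply]
    rcases le_total l l' with h | h
    · rw [min_eq_left h, max_eq_right h, min_eq_left (gridPoint_monotone b h)]; ring
    · rw [min_eq_right h, max_eq_left h, min_eq_right (gridPoint_monotone b h)]; ring
  have hmean : ∀ l, ∫ ω, f (U 0 ω) l ∂P = 0 := by
    intro l
    simp only [f]
    rw [integral_sub (integrable_const _)
      ((memLp_indicator_Iic (hmeas 0) _).integrable (by simp)),
      integral_indicator_Iic (hmeas 0) (hunif 0) (hmem l)]
    simp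
  refine ⟨posSemidef_of_covariance hL2 hcov, ?_⟩
  have hclt := tendstoInDistribution_inv_sqrt_smul_sum (X := fun i ω => f (U i ω)) hL2 hmean hcov
    (hindep.comp (fun _ => f) fun _ => hf)
    (fun i => (identDistrib_of_isUniform hmeas hunif i).comp hf)
  convert hclt using 3 with n ω
  ext l
  simp [f, countLE]

/-- Joint asymptotic normality of a function of the sample quantiles on the grid. -/
lemma tendstoInDistribution_sample_grid (hmeas : ∀ i, Measurable (U i)) (hindep : iIndepFun U P)
    (hunif : ∀ i, pdf.IsUniform (U i) (Set.Icc (0 : ℝ) 1) P volume) (b : ℕ) {g : ℝ → ℝ}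
    (hg : Differentiable ℝ g) :
    TendstoInDistribution (fun (n : ℕ) ω (l : Fin (2 * b + 1)) =>
      √n * (g (orderStat (fun i : Fin n => U i ω) (rank b n l)) - g (gridPoint b l)))
      atTop (fun (x : EuclideanSpace ℝ (Fin (2 * b + 1))) l => deriv g (gridPoint b l) * x l)
      (fun _ => P) (multivariateGaussian 0 (covU b)) := by
  have hclt := (tendstoInDistribution_countLE_grid hmeas hindep hunif b).2.continuous_comp
    (g := fun (x : EuclideanSpace ℝ (Fin (2 * b + 1))) l => deriv g (gridPoint b l) * x l)
    (by fun_prop)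
  -- Slutsky: the difference from the linear statistic is the delta-method remainder plus `g'(u)`
  -- times the quantile linearisation error.
  refine tendstoInDistribution_of_tendstoInMeasure_sub _ _ hclt (tendstoInMeasure_pi fun l => ?_)
    fun n => ?_
  · have hB := tendstoInMeasure_orderStat_sub_countLE hmeas hindep hunif (gridPoint_nonneg b l)
      (gridPoint_lt_one b l)
    have hbdd := (boundedInProbability_countLE hmeas hindep hunif
      ⟨gridPoint_nonneg b l, (gridPoint_lt_one b l).le⟩).of_tendstoInMeasure_sub hB
    have hR := tendstoInMeasure_deltaMethod hbdd (hg (gridPoint b l)).hasDerivAt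
    convert tendstoInMeasure_add_const_mul hR hB (deriv g (gridPoint b l)) using 3 with n ω
    simp [rank]
    ring
  · refine (measurable_pi_lambda _ fun l => ?_).aemeasurable
    have ho : Measurable fun ω => orderStat (fun i : Fin n => U i ω) (rank b n l) :=
      (measurable_orderStat n _).comp (measurable_pi_lambda _ fun i => hmeas i)
    exact ((hg.continuous.measurable.comp ho).sub_const _).const_mul _

/-- The matrix `(2b+1)⁻¹ Φ_b† ∇g(u)` of the linear map that turns the limit of the centred
sample quantiles into the limit of the centred coefficient estimates. -/
def coeffMatrix (b : ℕ) (g : ℝ → ℝ) : Matrix (Fin (2 * b + 1)) (Fin (2 * b + 1)) ℂ :=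
  (1 / (2 * (b : ℂ) + 1)) • ((Phi b)ᴴ * diagonal fun l => ((deriv g (gridPoint b l) : ℝ) : ℂ))

lemma covGC_eq (b : ℕ) (g : ℝ → ℝ) :
    covGC b g = (diagonal fun l => ((deriv g (gridPoint b l) : ℝ) : ℂ)) *
      (covU b).map (fun r : ℝ => (r : ℂ)) *
      diagonal fun l => ((deriv g (gridPoint b l) : ℝ) : ℂ) := by
  ext k l
  simp [covGC, covG, gradG, diagonal_transpose]

/-- The derivatives and the scalar are real, so the adjoint moves only `Φ_b`. This matches the
stated covariance with that of the image of `N(0, K_U)` under `coeffMatrix`. -/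
lemma covA_eq (b : ℕ) (g : ℝ → ℝ) :
    covA b g = coeffMatrix b g * (covU b).map (fun r : ℝ => (r : ℂ)) * (coeffMatrix b g)ᴴ := by
  have hstar : star (1 / (2 * (b : ℂ) + 1)) = 1 / (2 * (b : ℂ) + 1) := by
    simp
  have hd : star (fun l => ((deriv g (gridPoint b l) : ℝ) : ℂ)) =
      fun l => ((deriv g (gridPoint b l) : ℝ) : ℂ) := by
    ext l; simp
  rw [covA, coeffMatrix, covGC_eq, conjTranspose_smul, hstar, conjTranspose_mul,
    conjTranspose_conjTranspose, diagonal_conjTranspose, hd]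
  simp only [smul_mul_assoc, mul_smul_comm, smul_smul, Matrix.mul_assoc]
  rw [div_mul_div_comm, one_mul, sq]

lemma pcovA_eq (b : ℕ) (g : ℝ → ℝ) :
    pcovA b g = coeffMatrix b g * (covU b).map (fun r : ℝ => (r : ℂ)) * (coeffMatrix b g)ᵀ := by
  rw [pcovA, coeffMatrix, covGC_eq, transpose_smul, transpose_mul, diagonal_transpose]
  simp only [smul_mul_assoc, mul_smul_comm, smul_smul, Matrix.mul_assoc]
  rw [div_mul_div_comm, one_mul, sq]

/-- Joint asymptotic normality of the estimates of the Fourier coefficients. -/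
lemma tendstoInDistribution_coeffEst (hmeas : ∀ i, Measurable (U i)) (hindep : iIndepFun U P)
    (hunif : ∀ i, pdf.IsUniform (U i) (Set.Icc (0 : ℝ) 1) P volume) {b : ℕ} {g : ℝ → ℝ}
    {a : Fin (2 * b + 1) → ℂ} (hg : ∀ t : ℝ, (g t : ℂ) = expVec b t ⬝ᵥ a) :
    TendstoInDistribution (fun (n : ℕ) (ω : Ω) => ((Real.sqrt n : ℝ) : ℂ) •
        (coeffEst b g (fun i : Fin n => U i ω) - a)) atTop (mulVecReal (coeffMatrix b g))
      (fun _ => P) (multivariateGaussian 0 (covU b)) := by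
  have h := (tendstoInDistribution_sample_grid hmeas hindep hunif b
    (differentiable_of_eq_expVec_dotProduct hg)).continuous_comp
    (g := fun y : Fin (2 * b + 1) → ℝ =>
      (1 / (2 * (b : ℂ) + 1)) • ((Phi b)ᴴ *ᵥ fun l => (y l : ℂ)))
    (by unfold mulVec dotProduct; fun_prop)
  convert h using 1
  · ext n ω : 2
    -- Writing `a` as the estimator at the grid values makes the error linear in the sample
    -- deviations.
    conv_lhs => rw [← smul_conjTranspose_Phi_mulVec_grid hg]
    rw [coeffEst, ← smul_sub, ← mulVec_sub, smul_comm, ← mulVec_smul]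
    simp only [Function.comp_apply]
    congr 2
    ext l
    simp [sampleVec]
  · ext x k
    simp only [Function.comp_apply]
    rw [mulVecReal_apply, coeffMatrix]
    simp [mulVec, dotProduct, Finset.mul_sum, mul_assoc]

end Limit

end RandomSampling

end

theorem theorem3 {Ω : Type*} [MeasurableSpace Ω] (P : Measure Ω) [IsProbabilityMeasure P]
    (U : ℕ → Ω → ℝ) (hU_meas : ∀ i, Measurable (U i)) (hU_indep : iIndepFun U P)
    (hU_unif : ∀ i, pdf.IsUniform (U i) (Set.Icc (0 : ℝ) 1) P volume)
    (b : ℕ) (g : ℝ → ℝ) (a : Fin (2 * b + 1) → ℂ)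
    (hg : ∀ t : ℝ, (g t : ℂ) = ∑ k : Fin (2 * b + 1),
      a k * Complex.exp (2 * (Real.pi : ℂ) * Complex.I * (RandomSampling.freq b k : ℂ) * (t : ℂ))) :
    (∃ ν : ProbabilityMeasure (Fin (2 * b + 1) → ℂ),
      RandomSampling.IsComplexGaussianVec (ν : Measure (Fin (2 * b + 1) → ℂ))
        (RandomSampling.covA b g) (RandomSampling.pcovA b g) ∧
      TendstoInDistribution
        (fun (n : ℕ) (ω : Ω) => ((Real.sqrt n : ℝ) : ℂ) •
          (RandomSampling.coeffEst b g (fun i : Fin n => U i ω) - a))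
        atTop id (fun _ => P) (ν : Measure (Fin (2 * b + 1) → ℂ))) ∧
    (∀ t : ℝ, ∃ ν : ProbabilityMeasure ℂ,
      RandomSampling.IsComplexGaussian (ν : Measure ℂ)
        (RandomSampling.varGt b g t) (RandomSampling.pvarGt b g t) ∧
      TendstoInDistribution
        (fun (n : ℕ) (ω : Ω) => ((Real.sqrt n : ℝ) : ℂ) *
          (RandomSampling.fieldEst b g (fun i : Fin n => U i ω) t - (g t : ℂ)))
        atTop id (fun _ => P) (ν : Measure ℂ)) := by
  have hg' : ∀ t : ℝ, (g t : ℂ) = RandomSampling.expVec b t ⬝ᵥ a := fun t => by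
    rw [hg t, dotProduct]
    exact Finset.sum_congr rfl fun k _ => mul_comm _ _
  have hlim := RandomSampling.tendstoInDistribution_coeffEst hU_meas hU_indep hU_unif hg'
  have hpsd := (RandomSampling.tendstoInDistribution_countLE_grid hU_meas hU_indep hU_unif b).1
  have hgauss := RandomSampling.isComplexGaussianVec_map_mulVecReal hpsd
    (RandomSampling.coeffMatrix b g)
  rw [← RandomSampling.covA_eq, ← RandomSampling.pcovA_eq] at hgauss
  have hprob := hgauss.gaussian.toIsProbabilityMeasure
  -- Convergence in distribution depends only on the limit's law, so the Gaussian image measure with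
  -- `id` can replace the limiting map.
  refine ⟨⟨⟨_, hprob⟩, hgauss, RandomSampling.tendstoInDistribution_id_map hlim⟩, fun t => ?_⟩
  have hgt := hgauss.map_dotProduct (RandomSampling.expVec b t)
  have hcont : Continuous fun z : Fin (2 * b + 1) → ℂ => RandomSampling.expVec b t ⬝ᵥ z := by
    unfold dotProduct
    fun_prop
  have hprobt := hgt.gaussian.toIsProbabilityMeasure
  refine ⟨⟨_, hprobt⟩, hgt, ?_⟩
  have h := (RandomSampling.tendstoInDistribution_id_map hlim).continuous_comp hcont
  rw [Function.comp_id] at h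
  have hfun : (fun (n : ℕ) (ω : Ω) => ((Real.sqrt n : ℝ) : ℂ) *
      (RandomSampling.fieldEst b g (fun i : Fin n => U i ω) t - (g t : ℂ))) =
      fun (n : ℕ) => (fun z => RandomSampling.expVec b t ⬝ᵥ z) ∘ fun ω =>
        ((Real.sqrt n : ℝ) : ℂ) •
          (RandomSampling.coeffEst b g (fun i : Fin n => U i ω) - a) := by
    ext n ω
    rw [Function.comp_apply, dotProduct_smul, dotProduct_sub, ← hg' t, smul_eq_mul,
      RandomSampling.fieldEst]
  rw [hfun]
  exact RandomSampling.tendstoInDistribution_id_map h
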